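/- Let $\Gamma$ be a connected, locally finite simple graph in which every vertex has degree $d$, and let $G$ be a group acting on $\Gamma$ by graph automorphisms (not necessarily faithfully) and transitively on the vertex set $V\Gamma$. For a vertex $\alpha$ let $G_\alpha$ be its stabilizer, $N(\alpha)$ its set of neighbours, and $K_\alpha$ the kernel of the action of $G_\alpha$ on $N(\alpha)$. Assume that $G$ acts locally like the dihedral group with $2d$ elements in its usual action on a set with $d$ elements; that is, the permutation group $G_\alpha/K_\alpha$ on $N(\alpha)$ is isomorphic, as a permutation group, to the dihedral group of order $2d$ acting on the $d$ vertices of a regular $d$-gon (by vertex-transitivity this does not depend on $\alpha$). Then at least one of the following holds. (1) The action of $G$ on $V\Gamma$ is nearly discrete: there is a $G$-invariant equivalence relation $\sigma$ on $V\Gamma$ with finite equivalence classes such that, if $K$ is the kernel of the action of $G$ on $V\Gamma/\sigma$, then all point stabilizers of the faithful action of $G/K$ on $V\Gamma/\sigma$ are finite. (2) $\Gamma$ essentially includes a tree: there is an integer $n\geq 0$ such that the graph $\Gamma_n$ contains a subgraph isomorphic to the 3-regular tree, where $\Gamma_n$ has vertex set $V\Gamma$ and two distinct vertices are adjacent in $\Gamma_n$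 if and only if their distance in $\Gamma$ is at most $n$. -/

import Mathlib

/-- The permutation group `G_α / K_α` induced on the neighbourhood `N(α)` of the vertex `α` by the
stabilizer `G_α`: its elements are the permutations of `N(α)` that are restrictions of elements
of `G_α`. -/
def localActionAt (G : Type*) {V : Type*} [Group G] [MulAction G V] (Γ : SimpleGraph V) (α : V) :
    Subgroup (Equiv.Perm (Γ.neighborSet α)) where
  carrier := {π | ∃ g ∈ MulAction.stabilizer G α, ∀ x : Γ.neighborSet α, (π x : V) = g • (x : V)}
  one_mem' := ⟨1, one_mem _, fun x => by simp⟩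
  mul_mem' := by
    rintro π ρ ⟨g, hg, hπ⟩ ⟨h, hh, hρ⟩
    exact ⟨g * h, mul_mem hg hh, fun x => by rw [Equiv.Perm.mul_apply, hπ, hρ, mul_smul]⟩
  inv_mem' := by
    rintro π ⟨g, hg, hπ⟩
    refine ⟨g⁻¹, inv_mem hg, fun x => ?_⟩
    rw [eq_inv_smul_iff, ← hπ]
    simp

/-- The usual action of the dihedral group of order `2 * d` on the `d` vertices of a regular
`d`-gon, which are labelled cyclically by `ZMod d`: rotations `x ↦ x + i` and
reflections `x ↦ -(x + i)`. -/
def dihedralPermHom (d : ℕ) : DihedralGroup d →* Equiv.Perm (ZMod d) where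
  toFun
    | .r i => Equiv.addRight i
    | .sr i => (Equiv.addRight i).trans (Equiv.neg (ZMod d))
  map_one' := by
    ext x
    change x + 0 = x
    rw [add_zero]
  map_mul' := by
    rintro (i | i) (j | j) <;> ext x <;> simp <;> ring

/-- The local action at `α` is the dihedral group with `2 * d` elements in its usual action on a
set with `d` elements: the two permutation groups are isomorphic, through an isomorphism `φ` of
groups and a bijection `e` of the sets acted on. If `G` is vertex-transitive, this does not
depend on `α`. -/
def ActsLocallyLikeDihedral (G : Type*) {V : Type*} [Group G] [MulAction G V]
    (Γ : SimpleGraph V) (d : ℕ) (α : V) : Prop :=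
  ∃ (φ : DihedralGroup d ≃* localActionAt G Γ α) (e : Γ.neighborSet α ≃ ZMod d),
    ∀ (t : DihedralGroup d) (x : Γ.neighborSet α),
      e ((φ t : Equiv.Perm (Γ.neighborSet α)) x) = dihedralPermHom d t (e x)

/-- A discrete action: it is faithful, and the stabilizers of points are finite. -/
def IsDiscreteAction (G Ω : Type*) [Group G] [MulAction G Ω] : Prop :=
  FaithfulSMul G Ω ∧ ∀ a : Ω, Finite (MulAction.stabilizer G a)

/-- A nearly discrete action: for some `G`-congruence `σ` with finite classes, the group `G / K`
acts discretely on `Ω / σ`, where `K` is the kernel of the action of `G` on `Ω / σ`. Here `G / K`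
is realized as the group of permutations of `Ω / σ` induced by `G`, the image of the
homomorphism from `G` to `Sym (Ω / σ)` with kernel `K`. -/
def IsNearlyDiscrete (G Ω : Type*) [Group G] [MulAction G Ω] : Prop :=
  ∃ σ : SMulCon G Ω, (∀ a : Ω, {b : Ω | σ.toSetoid a b}.Finite) ∧
    IsDiscreteAction (MulAction.toPermHom G σ.Quotient).range σ.Quotient

/-- The graph `Γ_n`: distinct vertices are adjacent if their distance in `Γ` is at most `n`. -/
def distPower {V : Type*} (Γ : SimpleGraph V) (n : ℕ) : SimpleGraph V where
  Adj a b := a ≠ b ∧ Γ.edist a b ≤ n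
  symm := ⟨fun a b h => ⟨h.1.symm, by rw [SimpleGraph.edist_comm]; exact h.2⟩⟩
  loopless := ⟨fun _ h => h.1 rfl⟩

/-- `Γ` essentially includes a tree: for some `n`, the graph `Γ_n` has a subgraph that is a
3-regular tree. -/
def EssentiallyIncludesTree {V : Type*} (Γ : SimpleGraph V) : Prop :=
  ∃ (n : ℕ) (T : (distPower Γ n).Subgraph),
    T.coe.IsTree ∧ ∀ v : T.verts, (T.coe.neighborSet v).ncard = 3

/-! Two consecutive darts form a turn if the first and last of their three vertices are adjacent on
the `d`-gon of neighbours of the middle one. Turns make the darts of the graph a digraph of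
out-degree two on which `G` is vertex-transitive, and reversing darts reverses its arcs. Turning and
reversing together reach every dart, since polygons and the graph are connected; so a property that
spreads along both holds everywhere.

If `G` is transitive on walks of some length `s` but not of length `s + 1`, fixing a walk of length
`s` forces fixing every dart (`smul_eq_self_of_not_walkTransitive_succ`). Otherwise `G` is
transitive on walks of all lengths, and at each depth the descendant sets of two out-neighbours of a
dart are equal or disjoint (`desc_eq_of_not_disjoint`).

If distinct out-neighbours share descendants at some depth, eventually having the same descendants
is an invariant relation with finite classes. The elements preserving each class form a normal
subgroup with finite orbits containing all dart stabilizers. In this case and in the rigid one,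
where the kernel plays that role, `isNearlyDiscrete_of_normal` applies.

If they never do, the descendants of a dart form a binary tree. Sending a dart to its initial vertex
is at most `d`-to-one, and Hall's theorem turns the exponential growth into an injective choice of
vertices forming a 3-regular tree (`Branches.essentiallyIncludesTree`). -/

/-! ### Turn systems and the rigidity of walks -/

/-- A digraph of out-degree two on which `G` acts transitively on vertices and on arcs, with an
arc-reversing involution that commutes with `G`, and such that the out-neighbour relation and the
involution generate the whole vertex set from any vertex. -/
structure TurnSystem (G A : Type*) [Group G] [MulAction G A] where
  out : A → Finset A
  rev : A → A
  card_out : ∀ a : A, (out a).card = 2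
  rev_rev : ∀ a : A, rev (rev a) = a
  rev_smul : ∀ (g : G) (a : A), rev (g • a) = g • rev a
  smul_mem_out : ∀ (g : G) {a b : A}, b ∈ out a → g • b ∈ out (g • a)
  rev_mem_out : ∀ {a b : A}, b ∈ out a → rev a ∈ out (rev b)
  exists_smul_eq : ∀ a b : A, ∃ g : G, g • a = b
  exists_swap : ∀ {a b c : A}, b ∈ out a → c ∈ out a → ∃ g : G, g • a = a ∧ g • b = c
  generate : ∀ S : Set A, S.Nonempty → (∀ a ∈ S, ∀ b ∈ out a, b ∈ S) → (∀ a ∈ S, rev a ∈ S) →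
    ∀ a, a ∈ S

namespace TurnSystem

variable {G A : Type*} [Group G] [MulAction G A] (D : TurnSystem G A)

/-- The first `s` steps of the sequence `p` are arcs of the digraph. -/
def IsWalk (s : ℕ) (p : ℕ → A) : Prop := ∀ i < s, p (i + 1) ∈ D.out (p i)

/-- The group `G` is transitive on walks of length `s`. -/
def WalkTransitive (s : ℕ) : Prop :=
  ∀ p q, D.IsWalk s p → D.IsWalk s q → ∃ g : G, ∀ i ≤ s, g • p i = q i

/-- The vertices reached from `a` by walks of length `t`. -/
noncomputable def desc : ℕ → A → Finset A
  | 0, a => {a}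
  | t + 1, a => by classical exact (D.out a).biUnion (desc t)

variable {D}

theorem out_nonempty (a : A) : (D.out a).Nonempty := by
  rw [← Finset.card_pos, D.card_out]; norm_num

theorem eq_or_eq_of_mem_out {a b c x : A} (hb : b ∈ D.out a) (hc : c ∈ D.out a) (hbc : b ≠ c)
    (hx : x ∈ D.out a) : x = b ∨ x = c := by
  classical
  have h : ({b, c} : Finset A) = D.out a := by
    apply Finset.eq_of_subset_of_card_le
    · intro y hy
      simp only [Finset.mem_insert, Finset.mem_singleton] at hy
      rcases hy with rfl | rfl <;> assumption
    · rw [D.card_out, Finset.card_pair hbc]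
  rw [← h] at hx
  simpa using hx

theorem IsWalk.mono {s t : ℕ} {p : ℕ → A} (h : D.IsWalk t p) (hst : s ≤ t) : D.IsWalk s p :=
  fun i hi => h i (hi.trans_le hst)

theorem IsWalk.smul {s : ℕ} {p : ℕ → A} (h : D.IsWalk s p) (g : G) :
    D.IsWalk s (fun i => g • p i) :=
  fun i hi => D.smul_mem_out g (h i hi)

variable (D) in
theorem exists_isWalk (a : A) : ∃ p : ℕ → A, p 0 = a ∧ ∀ s, D.IsWalk s p := by
  choose f hf using fun a : A => out_nonempty (D := D) a
  refine ⟨fun i => f^[i] a, rfl, fun s i _ => ?_⟩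
  simp only [Function.iterate_succ_apply']
  exact hf _

theorem IsWalk.reverse {s : ℕ} {p : ℕ → A} (h : D.IsWalk s p) :
    D.IsWalk s (fun i => D.rev (p (s - i))) := by
  intro i hi
  have := D.rev_mem_out (h (s - (i + 1)) (by omega))
  rwa [show s - (i + 1) + 1 = s - i by omega] at this

theorem walkTransitive_zero : D.WalkTransitive 0 := by
  intro p q _ _
  obtain ⟨g, hg⟩ := D.exists_smul_eq (p 0) (q 0)
  exact ⟨g, fun i hi => by rwa [Nat.le_zero.1 hi]⟩

/-- If `G` is transitive on walks of length `s` but not on those of length `s + 1`, then an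
element that fixes a walk of length `s` fixes the out-neighbours of its end. -/
theorem smul_eq_of_not_walkTransitive_succ {s : ℕ} (hs : D.WalkTransitive s)
    (hs' : ¬ D.WalkTransitive (s + 1)) {p : ℕ → A} (hp : D.IsWalk s p) {g : G}
    (hg : ∀ i ≤ s, g • p i = p i) {b : A} (hb : b ∈ D.out (p s)) : g • b = b := by
  by_contra hne
  apply hs'
  have hgb : g • b ∈ D.out (p s) := by
    have := D.smul_mem_out g hb
    rwa [hg s le_rfl] at this
  -- Since `g` moves `b`, the pointwise stabilizer of the walk is transitive on the two
  -- out-neighbours of its end, so transitivity extends by one step.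
  have key : ∀ x ∈ D.out (p s), ∀ y ∈ D.out (p s),
      ∃ k : G, (∀ i ≤ s, k • p i = p i) ∧ k • x = y := by
    have hinv : ∀ i ≤ s, g⁻¹ • p i = p i := fun i hi => by
      rw [inv_smul_eq_iff, hg i hi]
    intro x hx y hy
    rcases eq_or_eq_of_mem_out hb hgb (Ne.symm hne) hx with rfl | rfl <;>
    rcases eq_or_eq_of_mem_out hb hgb (Ne.symm hne) hy with rfl | rfl
    · exact ⟨1, fun i _ => one_smul _ _, one_smul _ _⟩
    · exact ⟨g, hg, rfl⟩
    · exact ⟨g⁻¹, hinv, inv_smul_smul _ _⟩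
    · exact ⟨1, fun i _ => one_smul _ _, one_smul _ _⟩
  intro q q' hq hq'
  obtain ⟨u, hu⟩ := hs q p (hq.mono (Nat.le_succ s)) hp
  obtain ⟨v, hv⟩ := hs q' p (hq'.mono (Nat.le_succ s)) hp
  have hx : u • q (s + 1) ∈ D.out (p s) := by
    have := D.smul_mem_out u (hq s (Nat.lt_succ_self s))
    rwa [hu s le_rfl] at this
  have hy : v • q' (s + 1) ∈ D.out (p s) := by
    have := D.smul_mem_out v (hq' s (Nat.lt_succ_self s))
    rwa [hv s le_rfl] at this
  obtain ⟨k, hk, hk'⟩ := key _ hx _ hy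
  refine ⟨v⁻¹ * k * u, fun i hi => ?_⟩
  rw [mul_smul, mul_smul, inv_smul_eq_iff]
  rcases Nat.le_succ_iff.1 hi with hi | rfl
  · rw [hu i hi, hk i hi, hv i hi]
  · exact hk'

/-- If `G` is transitive on walks of length `s` but not on those of length `s + 1`, then an
element that fixes a walk of length `s` acts trivially. -/
theorem smul_eq_self_of_not_walkTransitive_succ {s : ℕ} (hs : D.WalkTransitive s)
    (hs' : ¬ D.WalkTransitive (s + 1)) {p : ℕ → A} (hp : D.IsWalk s p) {g : G}
    (hg : ∀ i ≤ s, g • p i = p i) (a : A) : g • a = a := by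
  let S : Set A := {a | ∃ q : ℕ → A, D.IsWalk s q ∧ (∀ i ≤ s, g • q i = q i) ∧ q s = a}
  have hout : ∀ a ∈ S, ∀ b ∈ D.out a, b ∈ S := by
    rintro a ⟨q, hq, hgq, rfl⟩ b hb
    have hgb := smul_eq_of_not_walkTransitive_succ hs hs' hq hgq hb
    -- Drop the first vertex of the walk and append `b`.
    refine ⟨fun i => if i < s then q (i + 1) else b, ?_, ?_, ?_⟩
    · intro i hi
      rcases Nat.lt_or_ge (i + 1) s with h | h
      · simpa [hi, h] using hq (i + 1) h
      · obtain rfl : i + 1 = s := by omega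
        simpa using hb
    · intro i _
      by_cases h : i < s
      · simpa [h] using hgq (i + 1) h
      · simpa [h] using hgb
    · simp
  have hfix : ∀ a ∈ S, g • a = a := by
    rintro a ⟨q, -, hgq, rfl⟩
    exact hgq s le_rfl
  refine hfix a (D.generate S ⟨p s, p, hp, hg, rfl⟩ hout ?_ a)
  -- A walk of length `s` starting at `a` stays in `S`, so its vertices are fixed; its reverse is
  -- then a fixed walk ending at `rev a`.
  intro a ha
  obtain ⟨q, rfl, hq⟩ := D.exists_isWalk a
  have hqS : ∀ i, q i ∈ S := by
    intro i
    induction i with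
    | zero => exact ha
    | succ i ih => exact hout _ ih _ (hq (i + 1) i (Nat.lt_succ_self i))
  refine ⟨_, (hq s).reverse, fun i _ => ?_, by simp⟩
  rw [← D.rev_smul, hfix _ (hqS _)]

/-! ### Descendants -/

theorem mem_desc_succ {t : ℕ} {a x : A} :
    x ∈ D.desc (t + 1) a ↔ ∃ b ∈ D.out a, x ∈ D.desc t b := by
  classical
  simp [desc]

theorem mem_desc_zero {a x : A} : x ∈ D.desc 0 a ↔ x = a := by
  simp [desc]

theorem mem_desc_add {s t : ℕ} {a x : A} :
    x ∈ D.desc (s + t) a ↔ ∃ b ∈ D.desc s a, x ∈ D.desc t b := by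
  induction s generalizing a with
  | zero => simp [mem_desc_zero]
  | succ s ih =>
    rw [show s + 1 + t = s + t + 1 by omega]
    simp only [mem_desc_succ, ih]
    aesop

theorem mem_desc_one {a x : A} : x ∈ D.desc 1 a ↔ x ∈ D.out a := by
  simp [mem_desc_succ, mem_desc_zero]

theorem mem_desc_iff_exists_isWalk {t : ℕ} {a x : A} :
    x ∈ D.desc t a ↔ ∃ p : ℕ → A, D.IsWalk t p ∧ p 0 = a ∧ p t = x := by
  induction t generalizing a with
  | zero =>
    rw [mem_desc_zero]
    constructor
    · rintro rfl
      exact ⟨fun _ => x, fun i hi => absurd hi (Nat.not_lt_zero i), rfl, rfl⟩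
    · rintro ⟨p, -, rfl, rfl⟩
      rfl
  | succ t ih =>
    rw [mem_desc_succ]
    constructor
    · rintro ⟨b, hb, hx⟩
      obtain ⟨p, hp, rfl, rfl⟩ := ih.1 hx
      refine ⟨fun i => Nat.casesOn i a p, fun i hi => ?_, rfl, rfl⟩
      cases i with
      | zero => exact hb
      | succ i => exact hp i (by omega)
    · rintro ⟨p, hp, rfl, rfl⟩
      exact ⟨p 1, hp 0 (by omega), ih.2 ⟨fun i => p (i + 1), fun i hi => hp (i + 1) (by omega),
        rfl, rfl⟩⟩

theorem smul_mem_desc (g : G) {t : ℕ} {a x : A} (h : x ∈ D.desc t a) :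
    g • x ∈ D.desc t (g • a) := by
  obtain ⟨p, hp, rfl, rfl⟩ := mem_desc_iff_exists_isWalk.1 h
  exact mem_desc_iff_exists_isWalk.2 ⟨_, hp.smul g, rfl, rfl⟩

theorem smul_mem_desc_iff (g : G) {t : ℕ} {a x : A} :
    g • x ∈ D.desc t (g • a) ↔ x ∈ D.desc t a := by
  refine ⟨fun h => ?_, smul_mem_desc g⟩
  simpa using smul_mem_desc g⁻¹ h

theorem rev_mem_desc {t : ℕ} {a x : A} (h : x ∈ D.desc t a) : D.rev a ∈ D.desc t (D.rev x) := by
  obtain ⟨p, hp, rfl, rfl⟩ := mem_desc_iff_exists_isWalk.1 h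
  exact mem_desc_iff_exists_isWalk.2 ⟨_, hp.reverse, by simp, by simp⟩

theorem desc_nonempty (t : ℕ) (a : A) : (D.desc t a).Nonempty := by
  obtain ⟨p, rfl, hp⟩ := D.exists_isWalk a
  exact ⟨p t, mem_desc_iff_exists_isWalk.2 ⟨p, hp t, rfl, rfl⟩⟩

theorem desc_eq_smul {t : ℕ} {a b : A} (h : D.desc t a = D.desc t b) (g : G) :
    D.desc t (g • a) = D.desc t (g • b) := by
  ext x
  rw [← smul_inv_smul g x, smul_mem_desc_iff, smul_mem_desc_iff, h]

theorem desc_add_eq {t : ℕ} {a b : A} (h : D.desc t a = D.desc t b) (k : ℕ) :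
    D.desc (t + k) a = D.desc (t + k) b := by
  ext x
  simp only [mem_desc_add, h]

/-- If `G` is transitive on walks, then two vertices with a common in-neighbour have the same
descendants at distance `t` as soon as they have one of them in common. -/
theorem desc_eq_of_not_disjoint (hT : ∀ s, D.WalkTransitive s) {a b c : A} (hb : b ∈ D.out a)
    (hc : c ∈ D.out a) {t : ℕ} (h : ¬ Disjoint (D.desc t b) (D.desc t c)) :
    D.desc t b = D.desc t c := by
  rcases eq_or_ne b c with rfl | hbc
  · rfl
  have key : ∀ b' ∈ D.out a, ∀ c' ∈ D.out a, b' ≠ c' → ∀ x ∈ D.desc t b', x ∈ D.desc t c' →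
      D.desc t b' ⊆ D.desc t c' := by
    intro b hb c hc hbc x hxb hxc y hy
    obtain ⟨p, hp, rfl, rfl⟩ := mem_desc_iff_exists_isWalk.1 hxb
    obtain ⟨q, hq, hq0, rfl⟩ := mem_desc_iff_exists_isWalk.1 hy
    -- With `a` prepended to both walks, the element `g` fixes `a` and `b`, hence also the other
    -- out-neighbour `c`, while moving `x` to `y`.
    obtain ⟨g, hg⟩ := hT (t + 1) (fun i => Nat.casesOn i a p) (fun i => Nat.casesOn i a q)
      (fun i hi => by cases i with
        | zero => exact hb
        | succ i => exact hp i (by omega))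
      (fun i hi => by cases i with
        | zero => simpa [hq0] using hb
        | succ i => exact hq i (by omega))
    have h0 : g • a = a := hg 0 (Nat.zero_le _)
    have h1 : g • p 0 = p 0 := by simpa [hq0] using hg 1 (by omega)
    have ht : g • p t = q t := hg (t + 1) le_rfl
    have hgc : g • c = c := by
      have h2 : g • c ∈ D.out a := by
        have := D.smul_mem_out g hc
        rwa [h0] at this
      rcases eq_or_eq_of_mem_out hb hc hbc h2 with h3 | h3
      · rw [← h1] at h3
        exact absurd (smul_left_cancel g h3).symm hbc
      · exact h3
    have := smul_mem_desc g hxc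
    rwa [ht, hgc] at this
  obtain ⟨x, hxb, hxc⟩ := Finset.not_disjoint_iff.1 h
  exact (key b hb c hc hbc x hxb hxc).antisymm (key c hc b hb hbc.symm x hxc hxb)

/-- If two distinct out-neighbours of some vertex have a common descendant at distance `r`, then
out-neighbours of any vertex have the same descendants at distance `r`. -/
theorem forall_desc_eq_of_not_disjoint (hT : ∀ s, D.WalkTransitive s) {a b c : A}
    (hb : b ∈ D.out a) (hc : c ∈ D.out a) (hbc : b ≠ c) {r : ℕ}
    (h : ¬ Disjoint (D.desc r b) (D.desc r c)) {a' b' c' : A} (hb' : b' ∈ D.out a')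
    (hc' : c' ∈ D.out a') : D.desc r b' = D.desc r c' := by
  have heq := desc_eq_of_not_disjoint hT hb hc h
  have h1 : ∀ x ∈ D.out a, D.desc r x = D.desc r b := by
    intro x hx
    rcases eq_or_eq_of_mem_out hb hc hbc hx with rfl | rfl
    · rfl
    · exact heq.symm
  obtain ⟨g, rfl⟩ := D.exists_smul_eq a a'
  have h2 : ∀ x ∈ D.out (g • a), D.desc r x = D.desc r (g • b) := by
    intro x hx
    have := D.smul_mem_out g⁻¹ hx
    rw [inv_smul_smul] at this
    simpa using desc_eq_smul (h1 _ this) g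
  rw [h2 _ hb', h2 _ hc']

/-! ### The merging relation -/

variable (D) in
/-- Out-neighbours of any vertex have the same descendants at distance `r`. -/
def Merges (r : ℕ) : Prop := ∀ a b c : A, b ∈ D.out a → c ∈ D.out a → D.desc r b = D.desc r c

variable (D) in
/-- Two vertices are merging if they have the same descendants at some distance. -/
def Merging (a b : A) : Prop := ∃ m, D.desc m a = D.desc m b

theorem Merging.symm {a b : A} (h : D.Merging a b) : D.Merging b a :=
  h.imp fun _ => Eq.symm

theorem Merging.trans {a b c : A} (hab : D.Merging a b) (hbc : D.Merging b c) :
    D.Merging a c := by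
  obtain ⟨m, hm⟩ := hab
  obtain ⟨n, hn⟩ := hbc
  refine ⟨m + n, (desc_add_eq hm n).trans ?_⟩
  rw [add_comm]
  exact desc_add_eq hn m

theorem Merging.smul {a b : A} (h : D.Merging a b) (g : G) : D.Merging (g • a) (g • b) :=
  h.imp fun _ hm => desc_eq_smul hm g

section Merges

variable {r : ℕ}

theorem Merges.desc_succ_eq (hr : D.Merges r) {a b : A} (hb : b ∈ D.out a) {m : ℕ}
    (hm : r ≤ m) : D.desc (m + 1) a = D.desc m b := by
  obtain ⟨k, rfl⟩ := Nat.exists_eq_add_of_le hm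
  ext x
  rw [mem_desc_succ]
  constructor
  · rintro ⟨c, hc, hx⟩
    rwa [desc_add_eq (hr a b c hb hc) k]
  · exact fun hx => ⟨b, hb, hx⟩

theorem Merges.merging_out (hr : D.Merges r) {a b a' b' : A} (h : D.Merging a b)
    (ha : a' ∈ D.out a) (hb : b' ∈ D.out b) : D.Merging a' b' := by
  obtain ⟨m, hm⟩ := h
  refine ⟨m + r, ?_⟩
  rw [← hr.desc_succ_eq ha (Nat.le_add_left r m), ← hr.desc_succ_eq hb (Nat.le_add_left r m)]
  exact desc_add_eq hm (r + 1)

/-- Two walks of equal length from `z` stay merging at every step, by `merging_out`. -/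
theorem Merges.merging_of_mem_desc (hr : D.Merges r) {t : ℕ} {z x y : A} (hx : x ∈ D.desc t z)
    (hy : y ∈ D.desc t z) : D.Merging x y := by
  induction t generalizing x y with
  | zero =>
    rw [mem_desc_zero] at hx hy
    exact ⟨0, by rw [hx, hy]⟩
  | succ t ih =>
    rw [mem_desc_add] at hx hy
    obtain ⟨x', hx', hx⟩ := hx
    obtain ⟨y', hy', hy⟩ := hy
    exact hr.merging_out (ih hx' hy') (mem_desc_one.1 hx) (mem_desc_one.1 hy)

/-- Reverse the walks from `a` and `b` to a common descendant. -/
theorem Merging.exists_rev_mem {a b : A} (h : D.Merging a b) :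
    ∃ m z, D.rev a ∈ D.desc m z ∧ D.rev b ∈ D.desc m z := by
  obtain ⟨m, hm⟩ := h
  obtain ⟨c, hc⟩ := desc_nonempty (D := D) m a
  exact ⟨m, D.rev c, rev_mem_desc hc, rev_mem_desc (hm ▸ hc)⟩

theorem Merges.merging_rev (hr : D.Merges r) {a b : A} (h : D.Merging a b) :
    D.Merging (D.rev a) (D.rev b) := by
  obtain ⟨m, z, ha, hb⟩ := h.exists_rev_mem
  exact hr.merging_of_mem_desc ha hb

/-- The depth at which `a` and `b` merge is not bounded in advance, but every descendant set at
depth at least `r` is one at depth exactly `r`. So `rev a` and `rev b` lie in a common `desc r w`.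
Then `rev w` lies in `desc r a`, which leaves finitely many `w`, and each allows finitely many `b`.
-/
theorem Merges.finite_setOf_merging (hr : D.Merges r) (a : A) : {b | D.Merging a b}.Finite := by
  apply ((D.desc r a).finite_toSet.biUnion fun w _ =>
    ((D.desc r (D.rev w)).finite_toSet.image D.rev)).subset
  intro b hab
  have key : ∀ (t : ℕ) (z : A), r ≤ t → ∃ w, D.desc t z = D.desc r w := by
    intro t z ht
    induction t, ht using Nat.le_induction generalizing z with
    | base => exact ⟨z, rfl⟩
    | succ t ht ih =>
      obtain ⟨c, hc⟩ := out_nonempty (D := D) z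
      rw [hr.desc_succ_eq hc ht]
      exact ih c
  obtain ⟨m, hm⟩ := hab
  have hm' := desc_add_eq hm r
  obtain ⟨c, hc⟩ := desc_nonempty (D := D) (m + r) a
  obtain ⟨w, hw⟩ := key (m + r) (D.rev c) (Nat.le_add_left r m)
  have ha : D.rev a ∈ D.desc r w := hw ▸ rev_mem_desc hc
  have hb : D.rev b ∈ D.desc r w := hw ▸ rev_mem_desc (hm' ▸ hc)
  have ha' := rev_mem_desc ha
  rw [D.rev_rev] at ha'
  refine Set.mem_biUnion ha' ⟨D.rev b, ?_, D.rev_rev b⟩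
  rwa [D.rev_rev]

/-- The property spreads from `a` along arcs and reversals, hence to all vertices by `generate`. -/
theorem Merges.smul_merging (hr : D.Merges r) {g : G} {a : A} (hg : g • a = a) (b : A) :
    D.Merging (g • b) b := by
  refine D.generate {b | D.Merging (g • b) b} ⟨a, 0, by rw [hg]⟩ ?_ ?_ b
  · exact fun b hb c hc => hr.merging_out hb (D.smul_mem_out g hc) hc
  · intro b hb
    have := hr.merging_rev hb
    rwa [D.rev_smul] at this

end Merges

/-! ### Branching digraphs -/

/-- Distinct out-neighbours of a vertex have no common descendants at the same distance. -/
def Branches (D : TurnSystem G A) : Prop :=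
  ∀ a b c : A, b ∈ D.out a → c ∈ D.out a → b ≠ c → ∀ t, Disjoint (D.desc t b) (D.desc t c)

theorem Branches.card_desc (hD : D.Branches) (t : ℕ) (a : A) : (D.desc t a).card = 2 ^ t := by
  classical
  induction t generalizing a with
  | zero => simp [desc]
  | succ t ih =>
    have : D.desc (t + 1) a = (D.out a).biUnion (D.desc t) := by
      ext x; simp [mem_desc_succ]
    rw [this, Finset.card_biUnion fun b hb c hc hbc => hD a b c hb hc hbc t,
      Finset.sum_congr rfl fun b _ => ih b, Finset.sum_const, D.card_out, pow_succ', smul_eq_mul]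

theorem Branches.eq_of_mem_desc (hD : D.Branches) {s k : ℕ} {a b c x : A}
    (hb : b ∈ D.desc s a) (hc : c ∈ D.desc s a) (hxb : x ∈ D.desc k b) (hxc : x ∈ D.desc k c) :
    b = c := by
  induction s generalizing a with
  | zero => rw [mem_desc_zero.1 hb, mem_desc_zero.1 hc]
  | succ s ih =>
    obtain ⟨b', hb', hb⟩ := mem_desc_succ.1 hb
    obtain ⟨c', hc', hc⟩ := mem_desc_succ.1 hc
    rcases eq_or_ne b' c' with rfl | hne
    · exact ih hb hc
    · exact absurd (mem_desc_add.2 ⟨c, hc, hxc⟩)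
        (Finset.disjoint_left.1 (hD a b' c' hb' hc' hne (s + k)) (mem_desc_add.2 ⟨b, hb, hxb⟩))

/-- By walk transitivity the stabilizer of `a` is transitive on each level, so two levels that meet
coincide; their sizes are `2 ^ s` and `2 ^ t`. -/
theorem Branches.level_unique (hD : D.Branches) (hT : ∀ s, D.WalkTransitive s) {s t : ℕ}
    {a x : A} (hs : x ∈ D.desc s a) (ht : x ∈ D.desc t a) : s = t := by
  have key : ∀ s t : ℕ, x ∈ D.desc s a → x ∈ D.desc t a → D.desc s a ⊆ D.desc t a := by
    intro s t hs ht y hy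
    obtain ⟨p, hp, hp0, rfl⟩ := mem_desc_iff_exists_isWalk.1 hs
    obtain ⟨q, hq, hq0, rfl⟩ := mem_desc_iff_exists_isWalk.1 hy
    obtain ⟨g, hg⟩ := hT s p q hp hq
    have h0 := hg 0 (Nat.zero_le _)
    rw [hp0, hq0] at h0
    have := smul_mem_desc g ht
    rwa [h0, hg s le_rfl] at this
  have := congrArg Finset.card ((key s t hs ht).antisymm (key t s ht hs))
  rw [hD.card_desc, hD.card_desc] at this
  exact Nat.pow_right_injective le_rfl this

/-- Either the digraph branches like a tree, or the group `G` has a normal subgroup with finite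
orbits that contains the pointwise stabilizer of some finite set. -/
theorem branches_or_exists_normal (D : TurnSystem G A) [Nonempty A] :
    ((∀ s, D.WalkTransitive s) ∧ D.Branches) ∨
      ∃ X : Subgroup G, X.Normal ∧ (∀ a : A, (MulAction.orbit X a).Finite) ∧
        ∃ F : Finset A, ∀ g : G, (∀ a ∈ F, g • a = a) → g ∈ X := by
  classical
  by_cases hT : ∀ s, D.WalkTransitive s
  · by_cases hB : D.Branches
    · exact Or.inl ⟨hT, hB⟩
    right
    -- One failure of disjointness spreads to all vertices by transitivity and gives the subgroup of
    -- elements moving each vertex within its merging class.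
    simp only [Branches, not_forall] at hB
    obtain ⟨a, b, c, hb, hc, hbc, r, hr⟩ := hB
    have hr' : D.Merges r := fun a' b' c' hb' hc' =>
      forall_desc_eq_of_not_disjoint hT hb hc hbc hr hb' hc'
    refine ⟨{ carrier := {g | ∀ a, D.Merging (g • a) a}
              one_mem' := fun a => ⟨0, by rw [one_smul]⟩
              mul_mem' := ?_
              inv_mem' := ?_ }, ⟨?_⟩, ?_, {a}, ?_⟩
    · intro g h hg hh x
      rw [mul_smul]
      exact (hg _).trans (hh x)
    · intro g hg x
      have := (hg (g⁻¹ • x)).symm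
      rwa [smul_inv_smul] at this
    · intro g hg h x
      have := (hg (h⁻¹ • x)).smul h
      rwa [smul_inv_smul, smul_smul, smul_smul] at this
    · intro x
      apply (hr'.finite_setOf_merging x).subset
      rintro _ ⟨⟨g, hg⟩, rfl⟩
      exact (hg x).symm
    · intro g hg
      exact hr'.smul_merging (hg a (Finset.mem_singleton_self a))
  · right
    have hT' : ∃ s, D.WalkTransitive s ∧ ¬ D.WalkTransitive (s + 1) := by
      by_contra! h
      exact hT fun s => Nat.rec walkTransitive_zero h s
    obtain ⟨s, hs, hs'⟩ := hT'
    obtain ⟨p, -, hp⟩ := D.exists_isWalk (Classical.arbitrary A)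
    refine ⟨(MulAction.toPermHom G A).ker, inferInstance, ?_, (Finset.range (s + 1)).image p, ?_⟩
    · intro a
      apply (Set.finite_singleton a).subset
      rintro _ ⟨⟨g, hg⟩, rfl⟩
      exact congrArg (fun π : Equiv.Perm A => π a) (MonoidHom.mem_ker.1 hg)
    · intro g hg
      rw [MonoidHom.mem_ker]
      ext a
      refine smul_eq_self_of_not_walkTransitive_succ hs hs' (hp s) (fun i hi => hg _ ?_) a
      exact Finset.mem_image_of_mem p (Finset.mem_range.2 (Nat.lt_succ_of_le hi))

end TurnSystem

/-! ### The 3-regular tree -/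

/-- A 3-regular tree on the natural numbers: the parent of `n ≠ 0` is `n / 2 - 1`. -/
def cubicTree : SimpleGraph ℕ where
  Adj m n := (m ≠ 0 ∧ n = m / 2 - 1) ∨ (n ≠ 0 ∧ m = n / 2 - 1)
  symm := ⟨fun _ _ h => h.symm⟩
  loopless := ⟨fun n h => by omega⟩

theorem cubicTree_adj {m n : ℕ} :
    cubicTree.Adj m n ↔ (m ≠ 0 ∧ n = m / 2 - 1) ∨ (n ≠ 0 ∧ m = n / 2 - 1) := Iff.rfl

/-- Passing to parents leads down to `0`. The largest vertex of a cycle would have two distinct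
neighbours not exceeding it, but its parent is the only one. -/
theorem isTree_cubicTree : cubicTree.IsTree := by
  refine ⟨⟨fun m n => ?_⟩, fun v c hc => ?_⟩
  · have key : ∀ n, cubicTree.Reachable n 0 := by
      intro n
      induction n using Nat.strong_induction_on with
      | _ n ih =>
        rcases eq_or_ne n 0 with rfl | hn
        · exact .refl _
        · have h : cubicTree.Adj n (n / 2 - 1) := Or.inl ⟨hn, rfl⟩
          exact h.reachable.trans (ih _ (by omega))
    exact (key m).trans (key n).symm
  · obtain ⟨u, hu, hmax⟩ := c.support.toFinset.exists_max_image id ⟨v, by simp⟩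
    rw [List.mem_toFinset] at hu
    have hc' := hc.rotate hu
    have hle : ∀ x ∈ (c.rotate u hu).support, x ≤ u := by
      intro x hx
      exact hmax x (by simpa using hx)
    have h1 := (c.rotate u hu).adj_snd hc'.not_nil
    have h2 := (c.rotate u hu).adj_penultimate hc'.not_nil
    have h3 : (c.rotate u hu).snd ≤ u := hle _ ((c.rotate u hu).getVert_mem_support 1)
    have h4 : (c.rotate u hu).penultimate ≤ u :=
      hle _ ((c.rotate u hu).getVert_mem_support ((c.rotate u hu).length - 1))
    have h5 := hc'.snd_ne_penultimate
    rw [cubicTree_adj] at h1 h2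
    omega

theorem ncard_neighborSet_cubicTree (n : ℕ) : (cubicTree.neighborSet n).ncard = 3 := by
  rcases eq_or_ne n 0 with rfl | hn
  · have : cubicTree.neighborSet 0 = ({1, 2, 3} : Finset ℕ) := by
      ext m
      simp only [SimpleGraph.mem_neighborSet, cubicTree_adj, Finset.coe_insert,
        Finset.coe_singleton, Set.mem_insert_iff, Set.mem_singleton_iff]
      omega
    rw [this, Set.ncard_coe_finset]
    rfl
  · have : cubicTree.neighborSet n = ({n / 2 - 1, 2 * n + 2, 2 * n + 3} : Finset ℕ) := by
      ext m
      simp only [SimpleGraph.mem_neighborSet, cubicTree_adj, Finset.coe_insert,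
        Finset.coe_singleton, Set.mem_insert_iff, Set.mem_singleton_iff]
      omega
    rw [this, Set.ncard_coe_finset, Finset.card_eq_three]
    exact ⟨_, _, _, by omega, by omega, by omega, rfl⟩

/-- A graph essentially includes a tree as soon as the 3-regular tree on the natural numbers
embeds with adjacent vertices going to vertices at bounded distance. -/
theorem essentiallyIncludesTree_of_injective {V : Type*} {Γ : SimpleGraph V} (n : ℕ) (φ : ℕ → V)
    (hφ : Function.Injective φ) (h : ∀ m ≠ 0, Γ.edist (φ (m / 2 - 1)) (φ m) ≤ n) :
    EssentiallyIncludesTree Γ := by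
  let f : SimpleGraph.Copy cubicTree (distPower Γ n) :=
    ⟨⟨φ, by
      rintro a b hab
      refine ⟨hφ.ne hab.ne, ?_⟩
      rcases hab with ⟨ha, rfl⟩ | ⟨hb, rfl⟩
      · rw [SimpleGraph.edist_comm]
        exact h a ha
      · exact h b hb⟩, hφ⟩
  refine ⟨n, f.toSubgraph, f.isoToSubgraph.isTree_iff.1 isTree_cubicTree, fun v => ?_⟩
  obtain ⟨m, rfl⟩ := f.isoToSubgraph.surjective v
  rw [← ncard_neighborSet_cubicTree m]
  exact (Set.ncard_congr' (f.isoToSubgraph.mapNeighborSet m)).symm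

/-- The family indexed by the nodes of the 3-regular tree on the natural numbers whose value at a
node is obtained by applying `c` to the value at the parent. -/
def heapRec {B : Type*} (r : B) (c : B → Fin 3 → B) (n : ℕ) : B :=
  if n = 0 then r else c (heapRec r c (n / 2 - 1)) (Fin.ofNat 3 n)
termination_by n
decreasing_by omega

theorem heapRec_zero {B : Type*} (r : B) (c : B → Fin 3 → B) : heapRec r c 0 = r := by
  rw [heapRec, if_pos rfl]

theorem heapRec_of_ne {B : Type*} (r : B) (c : B → Fin 3 → B) {n : ℕ} (hn : n ≠ 0) :
    heapRec r c n = c (heapRec r c (n / 2 - 1)) (Fin.ofNat 3 n) := by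
  rw [heapRec, if_neg hn]

/-! ### Embedding the tree by Hall's theorem -/

namespace TurnSystem

variable {G A : Type*} [Group G] [MulAction G A] {D : TurnSystem G A}

theorem edist_le_of_mem_desc {V : Type*} {Γ : SimpleGraph V} (h : A → V)
    (hadj : ∀ a, ∀ b ∈ D.out a, Γ.Adj (h a) (h b)) {k : ℕ} {a b : A} (hb : b ∈ D.desc k a) :
    Γ.edist (h a) (h b) ≤ k := by
  induction k generalizing a with
  | zero => simp [mem_desc_zero.1 hb]
  | succ k ih =>
    obtain ⟨c, hc, hb⟩ := mem_desc_succ.1 hb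
    have h1 : Γ.edist (h a) (h c) ≤ 1 := (SimpleGraph.edist_eq_one_iff_adj.2 (hadj a c hc)).le
    calc Γ.edist (h a) (h b) ≤ Γ.edist (h a) (h c) + Γ.edist (h c) (h b) :=
          SimpleGraph.edist_triangle
      _ ≤ 1 + k := add_le_add h1 (ih hb)
      _ = ((k + 1 : ℕ) : ℕ∞) := by push_cast; exact add_comm _ _

/-- In a branching digraph, a finite-to-one map that moves along arcs by bounded distance yields
an embedded tree. -/
theorem Branches.essentiallyIncludesTree [Nonempty A] (hD : D.Branches)
    (hT : ∀ s, D.WalkTransitive s) {V : Type*} {Γ : SimpleGraph V} (h : A → V)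
    (hadj : ∀ a, ∀ b ∈ D.out a, Γ.Adj (h a) (h b)) (d : ℕ)
    (hfib : ∀ (S : Finset A) (v : V), (∀ a ∈ S, h a = v) → S.card ≤ d) :
    EssentiallyIncludesTree Γ := by
  classical
  -- Each node needs up to three private children and `h` is at most `d`-to-one, so `2 ^ k > 3 * d`
  -- descendants suffice; `k > 0` keeps `a₀` from being a child.
  obtain ⟨k, hkpos, hk⟩ : ∃ k, 0 < k ∧ 3 * d < 2 ^ k :=
    ⟨3 * d + 1, Nat.succ_pos _, (Nat.lt_succ_self _).trans Nat.lt_two_pow_self⟩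
  have a₀ : A := Classical.arbitrary A
  let B := {b : A // ∃ t, b ∈ D.desc t a₀}
  have hdisj : ∀ b c : B, b ≠ c → Disjoint (D.desc k b.1) (D.desc k c.1) := by
    rintro ⟨b, s, hb⟩ ⟨c, t, hc⟩ hbc
    rw [Finset.disjoint_left]
    intro x hxb hxc
    have := hD.level_unique hT (mem_desc_add.2 ⟨b, hb, hxb⟩) (mem_desc_add.2 ⟨c, hc, hxc⟩)
    obtain rfl : s = t := by omega
    exact hbc (Subtype.ext (hD.eq_of_mem_desc hb hc hxb hxc))
  -- Hall's condition: requests coming from a set `F` of nodes number at most `3 * F.card`, while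
  -- the disjoint sets `desc k` have `F.card * 2 ^ k` elements in all, with at least a `1 / d`
  -- fraction as many images.
  obtain ⟨f, hf, hf'⟩ := (Finset.all_card_le_biUnion_card_iff_exists_injective
    fun x : B × Fin 3 => (D.desc k x.1.1).image h).1 (by
      intro S
      let F := S.image Prod.fst
      have h1 : S.card ≤ F.card * 3 := by
        have : S ⊆ F ×ˢ Finset.univ := fun x hx =>
          Finset.mem_product.2 ⟨Finset.mem_image_of_mem _ hx, Finset.mem_univ _⟩
        simpa using Finset.card_le_card this
      let U := F.biUnion fun b => D.desc k b.1
      have h2 : U.card = F.card * 2 ^ k := by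
        rw [Finset.card_biUnion fun b _ c _ hbc => hdisj b c hbc,
          Finset.sum_congr rfl fun b _ => hD.card_desc k b.1, Finset.sum_const, smul_eq_mul]
      have h3 : U.card ≤ d * (U.image h).card :=
        Finset.card_le_mul_card_image U d fun v _ =>
          hfib _ v fun a ha => (Finset.mem_filter.1 ha).2
      have h4 : U.image h ⊆ S.biUnion fun x : B × Fin 3 => (D.desc k x.1.1).image h := by
        intro v hv
        simp only [U, F, Finset.mem_image, Finset.mem_biUnion] at hv ⊢
        obtain ⟨a, ⟨b, ⟨x, hx, rfl⟩, ha⟩, rfl⟩ := hv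
        exact ⟨x, hx, a, ha, rfl⟩
      refine le_trans ?_ (Finset.card_le_card h4)
      by_contra! hlt
      have h5 : d * (U.image h).card ≤ d * (F.card * 3) :=
        Nat.mul_le_mul_left d (hlt.le.trans h1)
      have h6 : 0 < F.card := by omega
      have h7 : F.card * (3 * d) < F.card * 2 ^ k := Nat.mul_lt_mul_of_pos_left hk h6
      nlinarith)
  have hc : ∀ x : B × Fin 3, ∃ c : B, c.1 ∈ D.desc k x.1.1 ∧ h c.1 = f x := by
    intro x
    obtain ⟨c, hc, hcf⟩ := Finset.mem_image.1 (hf' x)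
    obtain ⟨t, ht⟩ := x.1.2
    exact ⟨⟨c, t + k, mem_desc_add.2 ⟨_, ht, hc⟩⟩, hc, hcf⟩
  choose c hcd hcf using hc
  have hc0 : ∀ x, c x ≠ ⟨a₀, 0, mem_desc_zero.2 rfl⟩ := by
    intro x hx
    obtain ⟨t, ht⟩ := x.1.2
    have h1 := mem_desc_add.2 ⟨_, ht, hcd x⟩
    rw [hx] at h1
    have := hD.level_unique hT h1 (mem_desc_zero.2 rfl)
    omega
  have hcinj : ∀ x y, h (c x).1 = h (c y).1 → x = y := by
    intro x y hxy
    rw [hcf, hcf] at hxy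
    exact hf hxy
  -- The root is a chosen child of `a₀`, not `a₀` itself, whose image could coincide with one chosen
  -- by Hall's theorem.
  let φ : ℕ → B := heapRec (c (⟨a₀, 0, mem_desc_zero.2 rfl⟩, 0)) fun b j => c (b, j)
  have hφ0 : φ 0 = c (⟨a₀, 0, mem_desc_zero.2 rfl⟩, 0) := heapRec_zero _ _
  have hφs : ∀ m ≠ 0, φ m = c (φ (m / 2 - 1), Fin.ofNat 3 m) := fun m hm => heapRec_of_ne _ _ hm
  have hφne : ∀ m, φ m ≠ ⟨a₀, 0, mem_desc_zero.2 rfl⟩ := by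
    intro m
    rcases eq_or_ne m 0 with rfl | hm
    · rw [hφ0]; exact hc0 _
    · rw [hφs m hm]; exact hc0 _
  refine essentiallyIncludesTree_of_injective k (fun m => h (φ m).1) ?_ ?_
  · intro m
    induction m using Nat.strong_induction_on with
    | _ m ih =>
      intro n hmn
      rcases eq_or_ne m 0 with rfl | hm <;> rcases eq_or_ne n 0 with rfl | hn
      · rfl
      · simp only [hφ0, hφs n hn] at hmn
        exact absurd (congrArg Prod.fst (hcinj _ _ hmn)).symm (hφne _)
      · simp only [hφ0, hφs m hm] at hmn
        exact absurd (congrArg Prod.fst (hcinj _ _ hmn)) (hφne _)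
      · simp only [hφs m hm, hφs n hn] at hmn
        have h1 := hcinj _ _ hmn
        have h2 := ih (m / 2 - 1) (by omega)
          (congrArg (fun b : B => h b.1) (congrArg Prod.fst h1))
        -- Siblings have different residues modulo 3: they are `2 * j + 2` and `2 * j + 3`, or `1`,
        -- `2`, `3` below the root.
        have h3 := congrArg Fin.val (congrArg Prod.snd h1)
        simp only [Fin.ofNat] at h3
        omega
  · intro m hm
    rw [hφs m hm]
    exact edist_le_of_mem_desc h hadj (hcd _)

end TurnSystem

/-! ### Near discreteness from a normal subgroup -/

/-- An action is nearly discrete if some normal subgroup with finite orbits contains the pointwise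
stabilizer of a finite subset of an auxiliary `G`-set on which point stabilizers have finite
orbits. -/
theorem isNearlyDiscrete_of_normal {G V A : Type*} [Group G] [MulAction G V] [MulAction G A]
    (X : Subgroup G) (hX : X.Normal) (horb : ∀ v : V, (MulAction.orbit X v).Finite)
    (F : Finset A) (hF : ∀ g : G, (∀ a ∈ F, g • a = a) → g ∈ X)
    (hfin : ∀ (v : V) (a : A), (MulAction.orbit (MulAction.stabilizer G v) a).Finite) :
    IsNearlyDiscrete G V := by
  let σ : SMulCon G V :=
    { toSetoid := MulAction.orbitRel X V
      smul := by
        rintro g _ y ⟨⟨x, hx⟩, rfl⟩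
        refine ⟨⟨g * x * g⁻¹, hX.conj_mem x hx g⟩, ?_⟩
        change (g * x * g⁻¹) • g • y = g • x • y
        simp only [smul_smul, inv_mul_cancel_right] }
  let mk : V → σ.Quotient := Quotient.mk σ.toSetoid
  have hmk : ∀ (g : G) (v : V), g • mk v = mk (g • v) := fun _ _ => rfl
  have hker : ∀ x ∈ X, MulAction.toPermHom G σ.Quotient x = 1 := by
    intro x hx
    ext q
    induction q using Quotient.inductionOn with
    | h v => exact Quotient.sound (s := σ.toSetoid) ⟨⟨x, hx⟩, rfl⟩
  refine ⟨σ, fun v => (horb v).subset fun w hw => ?_, ?_, ?_⟩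
  · exact Setoid.symm' σ.toSetoid hw
  · refine ⟨fun {π ρ} h => Subtype.ext (Equiv.ext h)⟩
  · intro q
    induction q using Quotient.inductionOn with
    | h v =>
    -- An element preserving the `X`-orbit of `v` can be corrected by an element of `X`, which acts
    -- trivially on the quotient, so as to fix `v`.
    have hlift : ∀ π : MulAction.stabilizer (MulAction.toPermHom G σ.Quotient).range
        (mk v), ∃ g : MulAction.stabilizer G v,
        MulAction.toPermHom G σ.Quotient g = π.1.1 := by
      rintro ⟨⟨_, g, rfl⟩, hg⟩
      have hg' : g • mk v = mk v := hg
      rw [hmk] at hg'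
      obtain ⟨⟨x, hx⟩, hxv⟩ := Quotient.exact hg'
      have hxv' : x • v = g • v := hxv
      refine ⟨⟨x⁻¹ * g, ?_⟩, ?_⟩
      · rw [MulAction.mem_stabilizer_iff, mul_smul, ← hxv', inv_smul_smul]
      · change MulAction.toPermHom G σ.Quotient (x⁻¹ * g) = MulAction.toPermHom G σ.Quotient g
        rw [map_mul, hker _ (X.inv_mem hx), one_mul]
    choose f hf using hlift
    have : ∀ a : F, Finite (MulAction.orbit (MulAction.stabilizer G v) a.1) :=
      fun a => (hfin v a.1).to_subtype
    -- Lifts that agree on `F` differ by an element of `X`, so the images of `F`, each in a finite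
    -- orbit, determine the permutation.
    refine Finite.of_injective (β := ∀ a : F, MulAction.orbit (MulAction.stabilizer G v) a.1)
      (fun π a => ⟨f π • a.1, MulAction.mem_orbit _ _⟩) ?_
    intro π ρ h
    have hX' : (f ρ : G)⁻¹ * f π ∈ X := by
      apply hF
      intro a ha
      have h1 : (f π : G) • a = (f ρ : G) • a := congrArg Subtype.val (congrFun h ⟨a, ha⟩)
      rw [mul_smul, h1, inv_smul_smul]
    have h2 := hker _ hX'
    rw [map_mul, map_inv, inv_mul_eq_one, hf, hf] at h2
    exact Subtype.ext (Subtype.ext h2.symm)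

/-! ### Turns from the local dihedral action -/

section LocallyDihedral

variable {G V : Type*} [Group G] [MulAction G V] {Γ : SimpleGraph V}

/-- The action on the darts of a graph induced by an action by graph automorphisms. -/
abbrev dartMulAction (haut : ∀ (g : G) (a b : V), Γ.Adj (g • a) (g • b) ↔ Γ.Adj a b) :
    MulAction G Γ.Dart where
  smul g a := ⟨(g • a.fst, g • a.snd), (haut g _ _).2 a.adj⟩
  one_smul a := SimpleGraph.Dart.ext _ _ (Prod.ext (one_smul G a.fst) (one_smul G a.snd))
  mul_smul g h a :=
    SimpleGraph.Dart.ext _ _ (Prod.ext (mul_smul g h a.fst) (mul_smul g h a.snd))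

/-- In a connected locally finite graph, stabilizers of vertices have finite orbits. -/
theorem finite_orbit_stabilizer [Γ.LocallyFinite] (hconn : Γ.Connected)
    (haut : ∀ (g : G) (a b : V), Γ.Adj (g • a) (g • b) ↔ Γ.Adj a b) (v w : V) :
    (MulAction.orbit (MulAction.stabilizer G v) w).Finite := by
  obtain ⟨p⟩ := hconn.preconnected w v
  induction p with
  | nil =>
    apply (Set.finite_singleton _).subset
    rintro _ ⟨g, rfl⟩
    exact g.2
  | cons h _ ih =>
    apply (ih.biUnion fun u _ => (Γ.neighborSet u).toFinite).subset
    rintro _ ⟨g, rfl⟩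
    exact Set.mem_biUnion ⟨g, rfl⟩ ((haut g.1 _ _).2 h.symm)

/-- A cyclic labelling of the neighbours of `α` for which the stabilizer of `α` induces the whole
symmetry group of the cycle. -/
structure DihedralLabelling (G : Type*) {V : Type*} [Group G] [MulAction G V] (Γ : SimpleGraph V)
    (d : ℕ) (α : V) where
  label : Γ.neighborSet α ≃ ZMod d
  two_ne_zero : (2 : ZMod d) ≠ 0
  adjacent : ∀ {g : G}, g • α = α → ∀ {p q p' q' : Γ.neighborSet α}, g • (p : V) = p' →
    g • (q : V) = q' → (label q = label p + 1 ∨ label q = label p - 1) →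
    (label q' = label p' + 1 ∨ label q' = label p' - 1)
  rotation : ∀ i, ∃ g : G, g • α = α ∧ ∀ p : Γ.neighborSet α, g • (p : V) = label.symm (label p + i)
  reflection : ∀ i, ∃ g : G, g • α = α ∧ ∀ p : Γ.neighborSet α, g • (p : V) = label.symm (i - label p)

theorem ActsLocallyLikeDihedral.nonempty_dihedralLabelling {d : ℕ} {α : V}
    (hloc : ActsLocallyLikeDihedral G Γ d α)
    (haut : ∀ (g : G) (a b : V), Γ.Adj (g • a) (g • b) ↔ Γ.Adj a b) :
    Nonempty (DihedralLabelling G Γ d α) := by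
  obtain ⟨φ, e, he⟩ := hloc
  refine ⟨⟨e, ?_, ?_, ?_, ?_⟩⟩
  · intro h2
    -- If `2 = 0`, the reflection `x ↦ -x` is trivial, contradicting the injectivity of `φ`.
    have h1 : φ (.sr 0) = φ 1 := by
      apply Subtype.ext
      ext x
      congr 1
      apply e.injective
      rw [he, he, map_one]
      change -(e x + 0) = e x
      linear_combination (-e x) * h2
    cases φ.injective h1
  · intro g hg p q p' q' hp hq h
    have hN : ∀ (k : G), k • α = α → ∀ x : Γ.neighborSet α, k • (x : V) ∈ Γ.neighborSet α := by
      intro k hk x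
      have := (haut k α x).2 x.2
      rwa [hk] at this
    have hg' : g⁻¹ • α = α := by rw [inv_smul_eq_iff, hg]
    let π : Equiv.Perm (Γ.neighborSet α) :=
      { toFun := fun x => ⟨g • (x : V), hN g hg x⟩
        invFun := fun x => ⟨g⁻¹ • (x : V), hN _ hg' x⟩
        left_inv := fun x => Subtype.ext (inv_smul_smul g (x : V))
        right_inv := fun x => Subtype.ext (smul_inv_smul g (x : V)) }
    obtain ⟨t, ht⟩ := φ.surjective ⟨π, g, hg, fun _ => rfl⟩
    have hπ : ∀ x, e (π x) = dihedralPermHom d t (e x) := by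
      intro x
      rw [← he, ht]
    have hp' : π p = p' := Subtype.ext hp
    have hq' : π q = q' := Subtype.ext hq
    rw [← hp', ← hq', hπ, hπ]
    cases t with
    | r i =>
      change e q + i = e p + i + 1 ∨ e q + i = e p + i - 1
      rcases h with h | h
      · left; rw [h]; ring
      · right; rw [h]; ring
    | sr i =>
      change -(e q + i) = -(e p + i) + 1 ∨ -(e q + i) = -(e p + i) - 1
      rcases h with h | h
      · right; rw [h]; ring
      · left; rw [h]; ring
  · intro i
    obtain ⟨g, hg, hgπ⟩ := (φ (.r i)).2
    refine ⟨g, hg, fun p => ?_⟩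
    rw [← hgπ]
    congr 1
    rw [Equiv.eq_symm_apply, he]
    rfl
  · intro i
    obtain ⟨g, hg, hgπ⟩ := (φ (.sr (-i))).2
    refine ⟨g, hg, fun p => ?_⟩
    rw [← hgπ]
    congr 1
    rw [Equiv.eq_symm_apply, he]
    change -(e p + -i) = i - e p
    ring

namespace DihedralLabelling

variable {d : ℕ} {α : V} (ℓ : DihedralLabelling G Γ d α)

/-- The vertices `x` and `y` are consecutive neighbours of `β` in the cyclic order transported
from `α`. -/
def Turn (x β y : V) : Prop :=
  ∃ (g : G) (p q : Γ.neighborSet α), g • β = α ∧ g • x = p ∧ g • y = q ∧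
    (ℓ.label q = ℓ.label p + 1 ∨ ℓ.label q = ℓ.label p - 1)

variable {ℓ}

/-- Any element carrying `β` to `α` may be used to test for a turn: two of them differ by an element
of the stabilizer of `α`, which preserves adjacency on the polygon. -/
theorem turn_iff (haut : ∀ (g : G) (a b : V), Γ.Adj (g • a) (g • b) ↔ Γ.Adj a b) {g : G} {x β y : V} {p : Γ.neighborSet α} (hβ : g • β = α) (hx : g • x = p) :
    ℓ.Turn x β y ↔ ∃ q : Γ.neighborSet α, g • y = q ∧
      (ℓ.label q = ℓ.label p + 1 ∨ ℓ.label q = ℓ.label p - 1) := by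
  constructor
  · rintro ⟨h, p', q', hβ', hx', hy', hpq⟩
    have hk : (g * h⁻¹) • α = α := by
      rw [mul_smul, inv_smul_eq_iff.2 hβ'.symm, hβ]
    have hp : (g * h⁻¹) • (p' : V) = p := by rw [mul_smul, ← hx', inv_smul_smul, hx]
    have hq : (g * h⁻¹) • (q' : V) = g • y := by rw [mul_smul, ← hy', inv_smul_smul]
    have hy : g • y ∈ Γ.neighborSet α := by
      have := (haut (g * h⁻¹) α q').2 q'.2
      rwa [hk, hq] at this
    exact ⟨⟨g • y, hy⟩, rfl, ℓ.adjacent hk (q' := ⟨g • y, hy⟩) hp hq hpq⟩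
  · rintro ⟨q, hy, hpq⟩
    exact ⟨g, p, q, hβ, hx, hy, hpq⟩

theorem Turn.symm {x β y : V} (h : ℓ.Turn x β y) : ℓ.Turn y β x := by
  obtain ⟨g, p, q, hβ, hx, hy, h⟩ := h
  refine ⟨g, q, p, hβ, hy, hx, ?_⟩
  rcases h with h | h
  · right; rw [h]; ring
  · left; rw [h]; ring

theorem Turn.smul {x β y : V} (h : ℓ.Turn x β y) (k : G) : ℓ.Turn (k • x) (k • β) (k • y) := by
  obtain ⟨g, p, q, hβ, hx, hy, h⟩ := h
  exact ⟨g * k⁻¹, p, q, by rw [mul_smul, inv_smul_smul, hβ], by rw [mul_smul, inv_smul_smul, hx],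
    by rw [mul_smul, inv_smul_smul, hy], h⟩

/-- Every dart is mapped by `G` to a dart ending at `α`. -/
theorem exists_smul_eq_label [MulAction.IsPretransitive G V]
    (haut : ∀ (g : G) (a b : V), Γ.Adj (g • a) (g • b) ↔ Γ.Adj a b) (a : Γ.Dart) :
    ∃ (g : G) (p : Γ.neighborSet α), g • a.snd = α ∧ g • a.fst = p := by
  obtain ⟨g, hg⟩ := MulAction.exists_smul_eq G a.snd α
  refine ⟨g, ⟨g • a.fst, ?_⟩, hg, rfl⟩
  have := (haut g _ _).2 a.adj.symm
  rwa [hg] at this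

variable (ℓ) in
theorem exists_finset_turn [MulAction.IsPretransitive G V]
    (haut : ∀ (g : G) (a b : V), Γ.Adj (g • a) (g • b) ↔ Γ.Adj a b) (a : Γ.Dart) :
    ∃ s : Finset Γ.Dart, s.card = 2 ∧
      ∀ b : Γ.Dart, b ∈ s ↔ b.fst = a.snd ∧ ℓ.Turn a.fst a.snd b.snd := by
  classical
  obtain ⟨g, p, hβ, hx⟩ := exists_smul_eq_label (α := α) haut a
  have hadj : ∀ q : Γ.neighborSet α, Γ.Adj a.snd (g⁻¹ • (q : V)) := by
    intro q
    rw [← haut g, hβ, smul_inv_smul]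
    exact q.2
  let b : ZMod d → Γ.Dart := fun i => ⟨(a.snd, g⁻¹ • (ℓ.label.symm i : V)), hadj _⟩
  have hb : Function.Injective b := by
    intro i j hij
    have : g⁻¹ • (ℓ.label.symm i : V) = g⁻¹ • (ℓ.label.symm j : V) :=
      congrArg (fun x : Γ.Dart => x.snd) hij
    exact ℓ.label.symm.injective (Subtype.ext (smul_left_cancel _ this))
  refine ⟨{b (ℓ.label p + 1), b (ℓ.label p - 1)}, Finset.card_pair fun h => ℓ.two_ne_zero ?_, ?_⟩
  · linear_combination hb h
  · intro c
    rw [turn_iff haut hβ hx, Finset.mem_insert, Finset.mem_singleton]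
    have hc : ∀ i, c = b i ↔ c.fst = a.snd ∧ g • c.snd = ℓ.label.symm i := by
      intro i
      rw [SimpleGraph.Dart.ext_iff, Prod.ext_iff, ← eq_inv_smul_iff]
    rw [hc, hc, ← and_or_left]
    apply and_congr_right
    intro _
    constructor
    · rintro (h | h)
      · exact ⟨_, h, Or.inl (by simp)⟩
      · exact ⟨_, h, Or.inr (by simp)⟩
    · rintro ⟨q, hq, h | h⟩
      · left; rw [← h, hq, Equiv.symm_apply_apply]
      · right; rw [← h, hq, Equiv.symm_apply_apply]

theorem exists_smul_dart_eq [MulAction.IsPretransitive G V]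
    (haut : ∀ (g : G) (a b : V), Γ.Adj (g • a) (g • b) ↔ Γ.Adj a b)
    (ℓ : DihedralLabelling G Γ d α) (a b : Γ.Dart) :
    ∃ g : G, g • a.fst = b.fst ∧ g • a.snd = b.snd := by
  obtain ⟨g, p, hg, hgp⟩ := exists_smul_eq_label (α := α) haut a
  obtain ⟨h, q, hh, hhq⟩ := exists_smul_eq_label (α := α) haut b
  obtain ⟨k, hk, hkp⟩ := ℓ.rotation (ℓ.label q - ℓ.label p)
  refine ⟨h⁻¹ * k * g, ?_, ?_⟩
  · rw [mul_smul, mul_smul, hgp, hkp, inv_smul_eq_iff, hhq]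
    simp
  · rw [mul_smul, mul_smul, hg, hk, inv_smul_eq_iff, hh]

theorem exists_smul_turn_eq [MulAction.IsPretransitive G V]
    (haut : ∀ (g : G) (a b : V), Γ.Adj (g • a) (g • b) ↔ Γ.Adj a b) {a : Γ.Dart} {y z : V}
    (hy : ℓ.Turn a.fst a.snd y) (hz : ℓ.Turn a.fst a.snd z) :
    ∃ g : G, g • a.fst = a.fst ∧ g • a.snd = a.snd ∧ g • y = z := by
  obtain ⟨g, p, hβ, hx⟩ := exists_smul_eq_label (α := α) haut a
  obtain ⟨q, hyq, hq⟩ := (turn_iff haut hβ hx).1 hy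
  obtain ⟨r, hzr, hr⟩ := (turn_iff haut hβ hx).1 hz
  by_cases hqr : q = r
  · refine ⟨1, one_smul _ _, one_smul _ _, ?_⟩
    rw [one_smul]
    apply smul_left_cancel g
    rw [hyq, hzr, hqr]
  -- The reflection fixing the label of `p` exchanges the two labels adjacent to it.
  · obtain ⟨k, hk, hkp⟩ := ℓ.reflection (2 * ℓ.label p)
    have hqr' : ℓ.label q ≠ ℓ.label r := ℓ.label.injective.ne hqr
    refine ⟨g⁻¹ * k * g, ?_, ?_, ?_⟩
    · rw [mul_smul, mul_smul, inv_smul_eq_iff, hx, hkp, two_mul, add_sub_cancel_right,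
        Equiv.symm_apply_apply]
    · rw [mul_smul, mul_smul, inv_smul_eq_iff, hβ, hk]
    · rw [mul_smul, mul_smul, inv_smul_eq_iff, hyq, hzr, hkp]
      congr 1
      rw [Equiv.symm_apply_eq]
      rcases hq with hq | hq <;> rcases hr with hr | hr
      · exact absurd (hq.trans hr.symm) hqr'
      · rw [hq, hr]; ring
      · rw [hq, hr]; ring
      · exact absurd (hq.trans hr.symm) hqr'

/-- Turning and reversal generate all darts from any one. -/
theorem forall_dart_mem [MulAction.IsPretransitive G V] (hconn : Γ.Connected)
    (haut : ∀ (g : G) (a b : V), Γ.Adj (g • a) (g • b) ↔ Γ.Adj a b)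
    (ℓ : DihedralLabelling G Γ d α) (S : Set Γ.Dart) (hS : S.Nonempty)
    (hturn : ∀ a ∈ S, ∀ b : Γ.Dart, b.fst = a.snd → ℓ.Turn a.fst a.snd b.snd → b ∈ S)
    (hrev : ∀ a ∈ S, a.symm ∈ S) (a : Γ.Dart) : a ∈ S := by
  have hvert : ∀ a ∈ S, ∀ b : Γ.Dart, b.snd = a.snd → b ∈ S := by
    intro a ha b hab
    obtain ⟨g, p, hβ, hx⟩ := exists_smul_eq_label (α := α) haut a
    have hadj : ∀ q : Γ.neighborSet α, Γ.Adj (g⁻¹ • (q : V)) a.snd := by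
      intro q
      rw [← haut g, hβ, smul_inv_smul]
      exact q.2.symm
    let c : ZMod d → Γ.Dart := fun i => ⟨(g⁻¹ • (ℓ.label.symm i : V), a.snd), hadj _⟩
    have hc : ∀ b : Γ.Dart, b.snd = a.snd → ∃ i, b = c i := by
      intro b hb
      have hbα : g • b.fst ∈ Γ.neighborSet α := by
        have := (haut g _ _).2 b.adj.symm
        rwa [hb, hβ] at this
      refine ⟨ℓ.label ⟨g • b.fst, hbα⟩, ?_⟩
      refine SimpleGraph.Dart.ext _ _ (Prod.ext ?_ hb)
      simp [c]
    -- Turning out of the vertex and then reversing moves an incoming dart to an adjacent one on the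
    -- polygon.
    have hstep : ∀ i j, (j = i + 1 ∨ j = i - 1) → c i ∈ S → c j ∈ S := by
      intro i j hij hi
      have hmem := hturn _ hi (c j).symm rfl
        ((turn_iff (p := ℓ.label.symm i) haut hβ (smul_inv_smul _ _)).2
          ⟨ℓ.label.symm j, smul_inv_smul _ _, by simpa using hij⟩)
      simpa using hrev _ hmem
    obtain ⟨i₀, hi₀⟩ := hc a rfl
    have hall : ∀ n : ℤ, c (i₀ + n) ∈ S := by
      intro n
      induction n using Int.induction_on with
      | zero => simpa [← hi₀] using ha
      | succ n ih => exact hstep _ _ (Or.inl (by push_cast; ring)) ih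
      | pred n ih => exact hstep _ _ (Or.inr (by push_cast; ring)) ih
    obtain ⟨i, rfl⟩ := hc b hab
    obtain ⟨n, hn⟩ := ZMod.intCast_surjective (i - i₀)
    have := hall n
    rwa [hn, add_sub_cancel] at this
  obtain ⟨b, hb⟩ := hS
  have key : ∀ u v : V, Γ.Walk u v → (∀ a : Γ.Dart, a.snd = u → a ∈ S) →
      ∀ a : Γ.Dart, a.snd = v → a ∈ S := by
    intro u v w
    induction w with
    | nil => exact id
    | cons h _ ih =>
      exact fun hu => ih fun a ha => hvert _ (hrev _ (hu ⟨(_, _), h.symm⟩ rfl)) a ha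
  obtain ⟨w⟩ := hconn.preconnected b.snd a.snd
  exact key _ _ w (hvert b hb) a rfl

/-- The digraph of turns on the darts of a graph with a dihedral labelling. -/
theorem exists_turnSystem [MulAction.IsPretransitive G V] (hconn : Γ.Connected)
    (haut : ∀ (g : G) (a b : V), Γ.Adj (g • a) (g • b) ↔ Γ.Adj a b)
    (ℓ : DihedralLabelling G Γ d α) :
    letI := dartMulAction haut
    ∃ D : TurnSystem G Γ.Dart, ∀ a, ∀ b ∈ D.out a, b.fst = a.snd := by
  let := dartMulAction haut
  choose out hcard hout using ℓ.exists_finset_turn haut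
  refine ⟨{ out := out
            rev := SimpleGraph.Dart.symm
            card_out := hcard
            rev_rev := SimpleGraph.Dart.symm_symm
            rev_smul := fun _ _ => rfl
            smul_mem_out := ?_
            rev_mem_out := ?_
            exists_smul_eq := ?_
            exists_swap := ?_
            generate := ?_ }, fun a b hb => ((hout a b).1 hb).1⟩
  · intro g a b hb
    rw [hout] at hb ⊢
    exact ⟨congrArg (g • ·) hb.1, hb.2.smul g⟩
  · intro a b hb
    rw [hout] at hb ⊢
    refine ⟨hb.1.symm, ?_⟩
    have := hb.2.symm
    rwa [← hb.1] at this
  · intro a b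
    obtain ⟨g, h1, h2⟩ := exists_smul_dart_eq haut ℓ a b
    exact ⟨g, SimpleGraph.Dart.ext _ _ (Prod.ext h1 h2)⟩
  · intro a b c hb hc
    rw [hout] at hb hc
    obtain ⟨g, h1, h2, h3⟩ := exists_smul_turn_eq haut hb.2 hc.2
    refine ⟨g, SimpleGraph.Dart.ext _ _ (Prod.ext h1 h2),
      SimpleGraph.Dart.ext _ _ (Prod.ext ?_ h3)⟩
    change g • b.fst = c.fst
    rw [hb.1, hc.1, h2]
  · intro S hS hturn hrev
    exact forall_dart_mem hconn haut ℓ S hS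
      (fun a ha b h1 h2 => hturn a ha b ((hout a b).2 ⟨h1, h2⟩)) hrev

end DihedralLabelling

end LocallyDihedral

theorem mainTheorem11 {G V : Type*} [Group G] [MulAction G V] (Γ : SimpleGraph V)
    [Γ.LocallyFinite] (hconn : Γ.Connected) (d : ℕ) (hdeg : Γ.IsRegularOfDegree d)
    (haut : ∀ (g : G) (a b : V), Γ.Adj (g • a) (g • b) ↔ Γ.Adj a b)
    (htrans : MulAction.IsPretransitive G V)
    (α : V) (hloc : ActsLocallyLikeDihedral G Γ d α) :
    IsNearlyDiscrete G V ∨ EssentiallyIncludesTree Γ := by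
  classical
  obtain ⟨ℓ⟩ := hloc.nonempty_dihedralLabelling haut
  let := dartMulAction haut
  obtain ⟨D, hD⟩ := ℓ.exists_turnSystem hconn haut
  have hdart : ∀ v : V, ∃ a : Γ.Dart, a.fst = v := by
    intro v
    obtain ⟨g, rfl⟩ := MulAction.exists_smul_eq G α v
    exact ⟨⟨(g • α, g • (ℓ.label.symm 0 : V)), (haut g _ _).2 (ℓ.label.symm 0).2⟩, rfl⟩
  have : Nonempty Γ.Dart := (hdart α).nonempty
  rcases D.branches_or_exists_normal with ⟨hT, hB⟩ | ⟨X, hX, horb, F, hF⟩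
  · right
    refine hB.essentiallyIncludesTree hT (fun a => a.fst) (fun a b hb => ?_) d fun S v hS => ?_
    · rw [hD a b hb]
      exact a.adj
    -- Darts starting at `v` are determined by their ends, among its `d` neighbours.
    · rw [← hdeg v, ← SimpleGraph.card_neighborFinset_eq_degree]
      refine Finset.card_le_card_of_injOn (fun a => a.snd) (fun a ha => ?_) fun a ha b hb hab => ?_
      · have := a.adj
        rw [hS a ha] at this
        simpa using this
      · exact SimpleGraph.Dart.ext _ _ (Prod.ext ((hS a ha).trans (hS b hb).symm) hab)
  · left
    refine isNearlyDiscrete_of_normal X hX (fun v => ?_) F hF fun v a => ?_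
    · obtain ⟨a, rfl⟩ := hdart v
      apply ((horb a).image fun b => b.fst).subset
      rintro _ ⟨x, rfl⟩
      exact ⟨x • a, ⟨x, rfl⟩, rfl⟩
    · have hfin := (finite_orbit_stabilizer hconn haut v a.fst).prod
        (finite_orbit_stabilizer hconn haut v a.snd)
      apply (hfin.preimage (SimpleGraph.Dart.toProd_injective (G := Γ)).injOn).subset
      rintro _ ⟨g, rfl⟩
      exact ⟨⟨g, rfl⟩, ⟨g, rfl⟩⟩
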